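/- All groups are finite. A class of groups is closed under isomorphism. For a class $\mathcal X$ containing the trivial group and a group $G$, let $G^{\mathcal X}$ be the intersection of all normal subgroups $N$ of $G$ with $G/N\in\mathcal X$. A formation is a class $\mathcal X$ closed under homomorphic images and such that, if $\mathcal X\neq\varnothing$, $G/G^{\mathcal X}\in\mathcal X$ for every group $G$. It is saturated if $G/\Phi(G)\in\mathcal X$ implies $G\in\mathcal X$, and hereditary if it is closed under taking subgroups. Write $\pi(\mathcal X)$ for the set of primes dividing the order of some group in $\mathcal X$, and call $G$ $\mathcal X$-critical if $G\notin\mathcal X$ but every proper subgroup of $G$ belongs to $\mathcal X$. For a function $f$ assigning to each prime $p$ a (possibly empty) formation $f(p)$, let $LF(f)$ be the class of all groups $G$ such that $G/C_G(H/K)\in f(p)$ for every chief factor $H/K$ of $G$ and every prime $p$ dividing $|H/K|$. The canonical local satellite of a non-empty saturated formation $\mathcal X$ is the unique such function $X$ with $\mathcal X=LF(X)$ and, for every prime $p$, $X(p)\subseteq\mathcal X$ and $G\in X(p)$ whenever $G/O_p(G)\in X(p)$. A non-empty saturated formation $\mathcal X$ with canonical local satellite $X$ satisfies the boundary condition in a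 class $\mathcal Y$ if $G\in\mathcal X$ whenever $G\in\mathcal Y$ and $G$ is $X(p)$-critical for at least one prime $p$; it satisfies the boundary condition if it does so in the class of all groups. **Proposition 4.9.** Let $\mathcal L$ be a non-empty formation and let $\mathcal F=\mathcal N\mathcal L$ be the class of all groups $G$ such that $G^{\mathcal L}$ is nilpotent. (i) If $\mathcal L$ is a hereditary saturated formation satisfying the boundary condition in the class of all soluble groups, then $\mathcal F$ is a saturated formation satisfying the boundary condition in the class of all soluble groups. (ii) If $\mathcal L$ is a formation of nilpotent groups with $\pi(\mathcal L)$ the set of all primes, then $\mathcal F$ is a saturated formation satisfying the boundary condition. -/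

import Mathlib

universe u

/-- A class of finite groups, closed under isomorphism.  All groups are finite. -/
structure GroupClass where
  /-- `F.Mem G` : the finite group `G` belongs to the class `F`. -/
  Mem : ∀ (G : Type u) [Group G] [Finite G], Prop
  /-- a class of groups contains with each group all isomorphic copies -/
  mem_of_equiv : ∀ {G H : Type u} [Group G] [Finite G] [Group H] [Finite H],
    G ≃* H → Mem G → Mem H

namespace GroupClass

/-- Inclusion of classes of groups. -/
def Subclass (F X : GroupClass.{u}) : Prop :=
  ∀ (G : Type u) [Group G] [Finite G], F.Mem G → X.Mem G

/-- The class of all finite groups. -/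
def all : GroupClass.{u} where
  Mem _ _ _ := True
  mem_of_equiv _ _ := trivial

/-- The class of all finite nilpotent groups. -/
def nilpotent : GroupClass.{u} where
  Mem G _ _ := Group.IsNilpotent G
  mem_of_equiv e h := by
    have : Group.IsNilpotent _ := h
    exact Group.nilpotent_of_mulEquiv e

/-- The class of all finite soluble groups. -/
def soluble : GroupClass.{u} where
  Mem G _ _ := Group.IsSolvable G
  mem_of_equiv e h := by
    have : Group.IsSolvable _ := h
    exact Group.isSolvable_of_surjective (f := e.toMonoidHom) e.surjective

/-- The residual `G^F`: the intersection of all normal subgroups `N` of `G` with `G/N ∈ F`. -/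
def residual (F : GroupClass.{u}) (G : Type u) [Group G] [Finite G] : Subgroup G :=
  sInf {N : Subgroup G | ∃ _ : N.Normal, F.Mem (G ⧸ N)}

instance residual_normal (F : GroupClass.{u}) (G : Type u) [Group G] [Finite G] :
    (F.residual G).Normal := by
  rw [residual, sInf_eq_iInf']
  exact Subgroup.normal_iInf_normal fun N => N.2.1

theorem map_residual_le (F : GroupClass.{u}) {G H : Type u} [Group G] [Finite G] [Group H]
    [Finite H] (e : G ≃* H) : (F.residual G).map e.toMonoidHom ≤ F.residual H := by
  refine le_sInf ?_
  rintro N ⟨hN, hF⟩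
  rw [Subgroup.map_le_iff_le_comap]
  refine sInf_le ⟨inferInstance, ?_⟩
  refine F.mem_of_equiv (QuotientGroup.congr (N.comap e.toMonoidHom) N e ?_).symm hF
  exact Subgroup.map_comap_eq_self_of_surjective e.surjective N

theorem map_residual (F : GroupClass.{u}) {G H : Type u} [Group G] [Finite G] [Group H]
    [Finite H] (e : G ≃* H) : (F.residual G).map e.toMonoidHom = F.residual H := by
  refine le_antisymm (F.map_residual_le e) fun x hx => ?_
  have h := F.map_residual_le e.symm (Subgroup.mem_map_of_mem _ hx)
  exact ⟨e.symm x, h, e.apply_symm_apply x⟩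

/-- The product `XF` of two classes: all groups `G` with `G^F ∈ X` (used for `1 ∈ F`). -/
def prod (X F : GroupClass.{u}) : GroupClass.{u} where
  Mem G _ _ := X.Mem (F.residual G)
  mem_of_equiv e h := X.mem_of_equiv
    ((e.subgroupMap _).trans (MulEquiv.subgroupCongr (F.map_residual e))) h

/-- The class contains some group. -/
def IsNonempty (F : GroupClass.{u}) : Prop :=
  ∃ (G : Type u) (_ : Group G) (_ : Finite G), F.Mem G

/-- A formation: a class closed under homomorphic images such that, if it is not empty,
`G/G^F ∈ F` for every group `G`. -/
structure IsFormation (F : GroupClass.{u}) : Prop where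
  of_surjective : ∀ {G H : Type u} [Group G] [Finite G] [Group H] [Finite H] (f : G →* H),
    Function.Surjective f → F.Mem G → F.Mem H
  quotient_residual : F.IsNonempty →
    ∀ (G : Type u) [Group G] [Finite G], F.Mem (G ⧸ F.residual G)

/-- `G ∈ F` whenever `G/Φ(G) ∈ F`. -/
def IsSaturated (F : GroupClass.{u}) : Prop :=
  ∀ (G : Type u) [Group G] [Finite G], F.Mem (G ⧸ frattini G) → F.Mem G

/-- `H ∈ F` whenever `H ≤ G ∈ F`. -/
def IsHereditary (F : GroupClass.{u}) : Prop :=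
  ∀ (G : Type u) [Group G] [Finite G] (H : Subgroup G), F.Mem G → F.Mem H

/-- `G` is `F`-critical: `G ∉ F`, but all proper subgroups of `G` are in `F`. -/
def IsCritical (F : GroupClass.{u}) (G : Type u) [Group G] [Finite G] : Prop :=
  ¬ F.Mem G ∧ ∀ H : Subgroup G, H ≠ ⊤ → F.Mem H

/-- `π(F)`: the set of all primes dividing the order of some group in `F`. -/
def primeSet (F : GroupClass.{u}) : Set Nat.Primes :=
  {p | ∃ (G : Type u) (_ : Group G) (_ : Finite G), F.Mem G ∧ (p : ℕ) ∣ Nat.card G}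

end GroupClass

/-- `H/K` is a chief factor of `G`. -/
structure IsChiefFactor {G : Type u} [Group G] (H K : Subgroup G) : Prop where
  normal_top : H.Normal
  normal_bot : K.Normal
  lt : K < H
  eq_or_eq : ∀ N : Subgroup G, N.Normal → K ≤ N → N ≤ H → N = K ∨ N = H

/-- The centralizer `C_G(H/K)` of a normal section `H/K` of `G`: the preimage in `G` of the
centralizer of `H/K` in `G/K`. -/
def sectionCentralizer {G : Type u} [Group G] (H K : Subgroup G) [K.Normal] : Subgroup G :=
  (Subgroup.centralizer (H.map (QuotientGroup.mk' K) : Set (G ⧸ K))).comap (QuotientGroup.mk' K)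

instance sectionCentralizer_normal {G : Type u} [Group G] (H K : Subgroup G) [hH : H.Normal]
    [K.Normal] : (sectionCentralizer H K).Normal := by
  have : (H.map (QuotientGroup.mk' K)).Normal := hH.map _ (QuotientGroup.mk'_surjective K)
  unfold sectionCentralizer
  infer_instance

/-- `O_p(G)`: the largest normal `p`-subgroup of `G`. -/
def pRadical (p : ℕ) (G : Type u) [Group G] : Subgroup G :=
  sSup {N : Subgroup G | N.Normal ∧ IsPGroup p N}

instance pRadical_normal (p : ℕ) (G : Type u) [Group G] : (pRadical p G).Normal :=
  Subgroup.sSup_normal _ fun _ h => h.1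

namespace GroupClass

/-- `G ∈ LF(f)`: `G/C_G(H/K) ∈ f(p)` for every chief factor `H/K` of `G` and every prime `p`
dividing `|H/K|`.  (The group `1` has no chief factors, so it always belongs to `LF(f)`.) -/
def MemLF (f : Nat.Primes → GroupClass.{u}) (G : Type u) [Group G] [Finite G] : Prop :=
  ∀ (H K : Subgroup G) [H.Normal] [K.Normal], IsChiefFactor H K →
    ∀ p : Nat.Primes, (p : ℕ) ∣ K.relIndex H → (f p).Mem (G ⧸ sectionCentralizer H K)

/-- `f` is a local satellite of `F`: every `f(p)` is a (possibly empty) formation, and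
`F = LF(f)`. -/
structure IsLocalSatellite (f : Nat.Primes → GroupClass.{u}) (F : GroupClass.{u}) : Prop where
  isFormation : ∀ p, (f p).IsFormation
  mem_iff : ∀ (G : Type u) [Group G] [Finite G], F.Mem G ↔ MemLF f G

/-- `f` is the canonical local satellite of `F`: a local satellite such that, for each prime `p`,
`f(p) ⊆ F`, and `G ∈ f(p)` whenever `G/O_p(G) ∈ f(p)`. -/
structure IsCanonicalLocalSatellite (f : Nat.Primes → GroupClass.{u}) (F : GroupClass.{u}) : Prop
    extends IsLocalSatellite f F where
  integrated : ∀ p, (f p).Subclass F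
  full : ∀ (p : Nat.Primes) (G : Type u) [Group G] [Finite G],
    (f p).Mem (G ⧸ pRadical p G) → (f p).Mem G

/-- `F` satisfies the `π`-boundary condition in `X`: `F` is a saturated formation with canonical
local satellite `f` (which is unique), and `G ∈ F` whenever `G ∈ X` is `f(p)`-critical for at
least one `p ∈ π`. -/
def SatisfiesBoundaryConditionIn (F : GroupClass.{u}) (π : Set Nat.Primes)
    (X : GroupClass.{u}) : Prop :=
  F.IsFormation ∧ F.IsSaturated ∧
    ∃ f : Nat.Primes → GroupClass.{u}, IsCanonicalLocalSatellite f F ∧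
      ∀ (G : Type u) [Group G] [Finite G], X.Mem G →
        (∃ p ∈ π, (f p).IsCritical G) → F.Mem G

end GroupClass

open Subgroup
open scoped commutatorElement

/-! ### Residuals and formations -/

namespace GroupClass

/-! The canonical local satellite of `nilpotent.prod L` is p ↦ `(pGroups p).prod L`
(`isCanonicalLocalSatellite_nilpotent_prod`): a normal subgroup is nilpotent exactly when it
centralizes the chief factors below it, and a p-group acting on a chief factor of order divisible by
p, induced by a normal subgroup, acts trivially. Saturation is a Frattini argument
(`isNilpotent_of_map_frattini`).

Let G be critical for N_p L, outside N L, of least order. Criticality passes to quotients, so all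
proper quotients lie in N L. If a minimal normal subgroup N is soluble, then G is primitive: N is a
self-centralizing q-group with a supplement M ≠ G. Here q ≠ p, as otherwise G is an extension of a
q-group by an image of M. For N ≤ T < G the p-group T^L meets N trivially, hence centralizes N,
hence is trivial; so T ∈ L, while G/N ∉ L (`exists_isPGroup_of_isCritical`).

(i) Such a T has a self-centralizing normal q-subgroup, so it lies in l(q), where l is the canonical
satellite of L (`IsCanonicalLocalSatellite.mem_of_centralizer_le`). Thus G/N is l(q)-critical and
the boundary condition for L puts it in L, a contradiction.

(ii) Such a T is nilpotent, hence a q-group. So G/N is a q-group, which makes G nilpotent, or it has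
prime order r ≠ q and lies in L because r ∈ π(L). Solubility of N must be proved: the critical case
is G simple with p-by-nilpotent proper subgroups, where a Frobenius-type fusion argument applied to
a prime q ≠ p contradicts perfectness (`isSolvable_of_forall_extension`). -/

theorem map_residual_le_of_surjective (F : GroupClass.{u}) {G H : Type u} [Group G] [Finite G]
    [Group H] [Finite H] (f : G →* H) (hf : Function.Surjective f) :
    (F.residual G).map f ≤ F.residual H := by
  refine le_sInf ?_
  rintro N ⟨hN, hF⟩
  rw [map_le_iff_le_comap]
  refine sInf_le ⟨inferInstance, F.mem_of_equiv ?_ hF⟩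
  have hs : Function.Surjective ((QuotientGroup.mk' N).comp f) :=
    (QuotientGroup.mk'_surjective N).comp hf
  refine (QuotientGroup.quotientKerEquivOfSurjective _ hs).symm.trans
    (QuotientGroup.quotientMulEquivOfEq ?_)
  rw [← MonoidHom.comap_ker, QuotientGroup.ker_mk']

theorem residual_le (F : GroupClass.{u}) {G : Type u} [Group G] [Finite G] (N : Subgroup G)
    [hN : N.Normal] (h : F.Mem (G ⧸ N)) : F.residual G ≤ N :=
  sInf_le ⟨hN, h⟩

namespace IsFormation

variable {F : GroupClass.{u}} (hF : F.IsFormation) {G H : Type u} [Group G] [Finite G]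
  [Group H] [Finite H]
include hF

theorem quotient_mem_of_residual_le (hne : F.IsNonempty) (N : Subgroup G) [N.Normal]
    (h : F.residual G ≤ N) : F.Mem (G ⧸ N) :=
  hF.of_surjective (QuotientGroup.map (F.residual G) N (MonoidHom.id G) h)
    (QuotientGroup.map_surjective_of_surjective _ _ (MonoidHom.id G)
        (QuotientGroup.mk'_surjective N) _)
    (hF.quotient_residual hne G)

theorem mem_of_residual_eq_bot (hne : F.IsNonempty) (h : F.residual G = ⊥) : F.Mem G :=
  F.mem_of_equiv QuotientGroup.quotientBot (hF.quotient_mem_of_residual_le hne ⊥ h.le)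

theorem map_residual_eq (hne : F.IsNonempty) (f : G →* H) (hf : Function.Surjective f) :
    (F.residual G).map f = F.residual H := by
  refine le_antisymm (F.map_residual_le_of_surjective f hf) ?_
  have : ((F.residual G).map f).Normal := (F.residual_normal G).map f hf
  refine F.residual_le _ (hF.of_surjective (QuotientGroup.map (F.residual G) _ f ?_) ?_
    (hF.quotient_residual hne G))
  · exact le_comap_map f _
  · exact QuotientGroup.map_surjective_of_surjective _ _ _
      ((QuotientGroup.mk'_surjective _).comp hf) _

end IsFormation

/-- A class closed under quotients and under subdirect products of two factors is a formation. -/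
theorem isFormation_of_inf {F : GroupClass.{u}}
    (hsurj : ∀ {G H : Type u} [Group G] [Finite G] [Group H] [Finite H] (f : G →* H),
      Function.Surjective f → F.Mem G → F.Mem H)
    (hinf : ∀ (G : Type u) [Group G] [Finite G] (A B : Subgroup G) [A.Normal] [B.Normal],
      F.Mem (G ⧸ A) → F.Mem (G ⧸ B) → F.Mem (G ⧸ (A ⊓ B))) : F.IsFormation where
  of_surjective := hsurj
  quotient_residual := by
    rintro ⟨G₀, _, _, h₀⟩ G _ _
    let S : Set (Subgroup G) := {N | ∃ _ : N.Normal, F.Mem (G ⧸ N)}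
    have hS : S.Nonempty := by
      refine ⟨⊤, inferInstance, hsurj (1 : G₀ →* _) (fun x => ⟨1, ?_⟩) h₀⟩
      exact (QuotientGroup.subsingleton_quotient_top (G := G)).elim _ _
    obtain ⟨N, hN⟩ := S.toFinite.exists_minimal hS
    have hres : F.residual G = N := by
      refine le_antisymm (sInf_le hN.1) (le_sInf fun M hM => ?_)
      obtain ⟨_, h1⟩ := hN.1
      obtain ⟨_, h2⟩ := hM
      exact inf_eq_left.1 (le_antisymm inf_le_left
        (hN.2 ⟨inferInstance, hinf G N M h1 h2⟩ inf_le_left))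
    obtain ⟨hn, h⟩ := hN.1
    exact F.mem_of_equiv (QuotientGroup.quotientMulEquivOfEq hres.symm) h

/-- Closure properties of a class `X` ensuring that `X.prod L` is a formation for every
non-empty formation `L`. -/
structure IsVariety (X : GroupClass.{u}) : Prop where
  of_surjective : ∀ {G H : Type u} [Group G] [Finite G] [Group H] [Finite H] (f : G →* H),
    Function.Surjective f → X.Mem G → X.Mem H
  of_injective : ∀ {G H : Type u} [Group G] [Finite G] [Group H] [Finite H] (f : G →* H),
    Function.Injective f → X.Mem H → X.Mem G
  prod : ∀ {G H : Type u} [Group G] [Finite G] [Group H] [Finite H],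
    X.Mem G → X.Mem H → X.Mem (G × H)

/-- The class of finite `p`-groups. -/
def pGroups (p : ℕ) : GroupClass.{u} where
  Mem G _ _ := IsPGroup p G
  mem_of_equiv e h := h.of_equiv e

theorem isVariety_pGroups (p : ℕ) : (pGroups.{u} p).IsVariety where
  of_surjective f hf h := IsPGroup.of_surjective h f hf
  of_injective f hf h := IsPGroup.of_injective h f hf
  prod {G H} _ _ _ _ hG hH := by
    rintro ⟨x, y⟩
    obtain ⟨k, hk⟩ := hG x
    obtain ⟨l, hl⟩ := hH y
    refine ⟨k + l, Prod.ext ?_ ?_⟩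
    · simp [pow_add, pow_mul, hk]
    · simp [pow_add, mul_comm (p ^ k), pow_mul, hl]

theorem isVariety_nilpotent : nilpotent.{u}.IsVariety where
  of_surjective f hf h := by
    have : Group.IsNilpotent _ := h
    exact Group.nilpotent_of_surjective f hf
  of_injective {G H} _ _ _ _ f hf h := by
    have : Group.IsNilpotent H := h
    exact Group.nilpotent_of_mulEquiv (f.ofInjective hf).symm
  prod hG hH := by
    have : Group.IsNilpotent _ := hG
    have : Group.IsNilpotent _ := hH
    change Group.IsNilpotent _
    infer_instance

theorem IsVariety.mem_map {X : GroupClass.{u}} (hX : X.IsVariety) {G H : Type u} [Group G] [Finite G]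
    [Group H] [Finite H] (f : G →* H) {S : Subgroup G} (h : X.Mem S) : X.Mem (S.map f) :=
  hX.of_surjective (f.subgroupMap S) (f.subgroupMap_surjective S) h

theorem IsVariety.mem_of_le {X : GroupClass.{u}} (hX : X.IsVariety) {G : Type u} [Group G] [Finite G]
    {S T : Subgroup G} (hST : S ≤ T) (h : X.Mem T) : X.Mem S :=
  hX.of_injective (inclusion hST) (inclusion_injective hST) h

theorem IsVariety.isFormation_prod {X L : GroupClass.{u}} (hX : X.IsVariety) (hL : L.IsFormation)
    (hne : L.IsNonempty) : (X.prod L).IsFormation := by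
  refine isFormation_of_inf (fun {G H} _ _ _ _ f hf h => ?_) fun G _ _ A B _ _ hA hB => ?_
  · have h1 : X.Mem ((L.residual G).map f) := hX.mem_map f h
    rw [hL.map_residual_eq hne f hf] at h1
    exact h1
  · let fA : G ⧸ (A ⊓ B) →* G ⧸ A := QuotientGroup.map _ _ (MonoidHom.id G) inf_le_left
    let fB : G ⧸ (A ⊓ B) →* G ⧸ B := QuotientGroup.map _ _ (MonoidHom.id G) inf_le_right
    have hfA : Function.Surjective fA :=
      QuotientGroup.map_surjective_of_surjective _ _ (MonoidHom.id G)
        (QuotientGroup.mk'_surjective A) _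
    have hfB : Function.Surjective fB :=
      QuotientGroup.map_surjective_of_surjective _ _ (MonoidHom.id G)
        (QuotientGroup.mk'_surjective B) _
    let R := L.residual (G ⧸ (A ⊓ B))
    have hRA : R ≤ (L.residual (G ⧸ A)).comap fA :=
      map_le_iff_le_comap.1 (L.map_residual_le_of_surjective fA hfA)
    have hRB : R ≤ (L.residual (G ⧸ B)).comap fB :=
      map_le_iff_le_comap.1 (L.map_residual_le_of_surjective fB hfB)
    -- The residual modulo A ∩ B embeds in the product of the residuals modulo A and modulo B.
    refine hX.of_injective (((fA.subgroupComap _).comp (inclusion hRA)).prod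
      ((fB.subgroupComap _).comp (inclusion hRB))) ?_ (hX.prod hA hB)
    rw [injective_iff_map_eq_one]
    rintro ⟨x, hx⟩ h
    obtain ⟨g, rfl⟩ := QuotientGroup.mk_surjective x
    have h1 : ((g : G) : G ⧸ A) = 1 := congrArg (fun z => (z.1 : G ⧸ A)) h
    have h2 : ((g : G) : G ⧸ B) = 1 := congrArg (fun z => (z.2 : G ⧸ B)) h
    exact Subtype.ext ((QuotientGroup.eq_one_iff g).2
      ⟨(QuotientGroup.eq_one_iff g).1 h1, (QuotientGroup.eq_one_iff g).1 h2⟩)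

end GroupClass

/-! ### Chief factors and their centralizers -/

section ChiefFactors

variable {G : Type*} [Group G]

theorem mem_sectionCentralizer {H K : Subgroup G} [K.Normal] {x : G} :
    x ∈ sectionCentralizer H K ↔ ∀ h ∈ H, ⁅x, h⁆ ∈ K := by
  simp only [sectionCentralizer, mem_comap, mem_centralizer_iff, coe_map, Set.forall_mem_image,
    SetLike.mem_coe]
  refine forall₂_congr fun h _ => ?_
  rw [← QuotientGroup.eq_one_iff, eq_comm, ← commutatorElement_eq_one_iff_mul_comm,
    ← map_commutatorElement]
  rfl

theorem le_sectionCentralizer_iff {A H K : Subgroup G} [K.Normal] :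
    A ≤ sectionCentralizer H K ↔ ⁅A, H⁆ ≤ K := by
  rw [commutator_le]
  exact forall₂_congr fun x _ => mem_sectionCentralizer

theorem exists_isChiefFactor [Finite G] (H : Subgroup G) [hH : H.Normal] (hne : H ≠ ⊥) :
    ∃ K : Subgroup G, IsChiefFactor H K := by
  let S : Set (Subgroup G) := {K | K.Normal ∧ K < H}
  obtain ⟨K, hK⟩ := S.toFinite.exists_maximal ⟨⊥, inferInstance, bot_lt_iff_ne_bot.2 hne⟩
  refine ⟨K, hH, hK.1.1, hK.1.2, fun N hN hKN hNH => ?_⟩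
  rcases hNH.lt_or_eq with h | h
  · exact Or.inl (le_antisymm (hK.2 ⟨hN, h⟩ hKN) hKN)
  · exact Or.inr h

/-- A nilpotent normal subgroup centralizes every chief factor. -/
theorem IsChiefFactor.le_sectionCentralizer_of_isNilpotent {H K R : Subgroup G} [R.Normal]
    [K.Normal] (h : IsChiefFactor H K) (hR : Group.IsNilpotent R) :
    R ≤ sectionCentralizer H K := by
  have := h.normal_top
  rw [le_sectionCentralizer_iff]
  rcases h.eq_or_eq (⁅R, H⁆ ⊔ K) inferInstance le_sup_right
    (sup_le (commutator_le_right R H) h.lt.le) with h1 | h1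
  · exact h1 ▸ le_sup_left
  exfalso
  have hn : ∀ n, (R.lowerCentralSeries n).Normal := fun n => by
    induction n with
    | zero => simpa
    | succ n ih => rw [Subgroup.lowerCentralSeries_succ]; infer_instance
  have key : ∀ n, H ≤ R.lowerCentralSeries n ⊔ K := fun n => by
    induction n with
    | zero => exact h1 ▸ sup_le_sup_right (commutator_le_left R H) K
    | succ n ih =>
      have := hn n
      have := hn (n + 1)
      -- Reading [H, R] ≤ γK as membership in a centralizer allows the term of the series and K to
      -- be checked separately.
      have h2 : H ≤ sectionCentralizer R (R.lowerCentralSeries (n + 1) ⊔ K) := by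
        refine ih.trans (sup_le ?_ ?_) <;> rw [le_sectionCentralizer_iff]
        · exact le_sup_left
        · exact (commutator_le_left K R).trans le_sup_right
      rw [le_sectionCentralizer_iff, commutator_comm] at h2
      exact h1 ▸ sup_le h2 le_sup_right
  obtain ⟨n, hn⟩ := (isNilpotent_iff_lowerCentralSeries R).1 hR
  exact h.lt.not_ge (by simpa [hn] using key n)

/-- A normal subgroup centralizing every chief factor below it is nilpotent. -/
theorem isNilpotent_of_forall_isChiefFactor [Finite G] (R : Subgroup G) [R.Normal]
    (h : ∀ H K : Subgroup G, IsChiefFactor H K → H ≤ R → ⁅H, R⁆ ≤ K) : Group.IsNilpotent R := by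
  have key : ∀ (m : ℕ) (H : Subgroup G), H.Normal → H ≤ R → Nat.card H ≤ m →
      ∃ n, H.subgroupOf R ≤ Subgroup.upperCentralSeries R n := by
    intro m
    induction m with
    | zero => exact fun H _ _ h0 => absurd Nat.card_pos h0.not_gt
    | succ m ih =>
      intro H hN hHR hcard
      by_cases hb : H = ⊥
      · exact ⟨0, by simp [hb]⟩
      obtain ⟨K, hK⟩ := exists_isChiefFactor H hb
      obtain ⟨n, hn⟩ := ih K hK.normal_bot (hK.lt.le.trans hHR) (by
        have : Nat.card K < Nat.card H := Set.ncard_lt_ncard (SetLike.coe_ssubset_coe.2 hK.lt)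
        omega)
      refine ⟨n + 1, fun x hx => Subgroup.mem_upperCentralSeries_succ_iff.2 fun y => hn ?_⟩
      exact h H K hK hHR (commutator_mem_commutator hx y.2)
  obtain ⟨n, hn⟩ := key _ R inferInstance le_rfl le_rfl
  exact ⟨n, top_le_iff.1 (by simpa using hn)⟩

/-- A normal subgroup inducing a `p`-group of automorphisms on a chief factor of order divisible
by `p` centralizes it. -/
theorem IsChiefFactor.le_sectionCentralizer_of_pow_mem [Finite G] {H K R : Subgroup G}
    [hRn : R.Normal] [H.Normal] [K.Normal] (h : IsChiefFactor H K) {p : ℕ} [Fact p.Prime]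
    (hp : p ∣ K.relIndex H) (hR : ∀ x ∈ R, ∃ k, x ^ p ^ k ∈ sectionCentralizer H K) :
    R ≤ sectionCentralizer H K := by
  have hHn : (H.map (QuotientGroup.mk' K)).Normal :=
    Normal.map inferInstance _ (QuotientGroup.mk'_surjective K)
  let V : Subgroup (G ⧸ K) := H.map (QuotientGroup.mk' K)
  let φ : G →* MulAut V := (MulAut.conjNormal (H := V)).comp (QuotientGroup.mk' K)
  have hφ (g : G) (v : V) : ((φ g v : V) : G ⧸ K) = g * v * (g : G ⧸ K)⁻¹ :=
    MulAut.conjNormal_apply _ _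
  have hφ1 (g : G) (hg : g ∈ sectionCentralizer H K) : φ g = 1 := by
    ext v
    have : (v : G ⧸ K) * g = g * v := hg v v.2
    rw [hφ, ← this, mul_inv_cancel_right]
    rfl
  have hpg : IsPGroup p (R.map φ) := by
    rintro ⟨_, x, hx, rfl⟩
    obtain ⟨k, hk⟩ := hR x hx
    exact ⟨k, Subtype.ext ((map_pow φ x _).symm.trans (hφ1 _ hk))⟩
  have hcard : p ∣ Nat.card V := by
    rwa [← QuotientGroup.ker_mk' K, relIndex_ker] at hp
  -- The p-group acts on a set of size divisible by p and fixes 1, so it fixes another point; the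
  -- fixed points form a normal subgroup, which by chiefness is all of H/K.
  obtain ⟨b, hb, hb1⟩ := hpg.exists_fixed_point_of_prime_dvd_card_of_fixed_point V hcard
    (a := 1) (fun m => map_one m.1)
  obtain ⟨⟨_, h₀, hh₀, rfl⟩, rfl⟩ : ∃ v : V, v = b := ⟨b, rfl⟩
  have hmem : h₀ ∈ sectionCentralizer R K := by
    rw [mem_sectionCentralizer]
    intro x hx
    have h1 := congrArg Subtype.val (hb ⟨φ x, x, hx, rfl⟩)
    replace h1 : (x : G ⧸ K) * h₀ * (x : G ⧸ K)⁻¹ = h₀ := (hφ _ _).symm.trans h1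
    rw [mul_inv_eq_iff_eq_mul] at h1
    exact (QuotientGroup.eq_one_iff _).1 (commutatorElement_eq_one_iff_mul_comm.2 h1.symm)
  rcases h.eq_or_eq (H ⊓ sectionCentralizer R K) inferInstance
    (le_inf h.lt.le (le_sectionCentralizer_iff.2 (commutator_le_left K R))) inf_le_left with h1 | h1
  · refine absurd (Subtype.ext ?_) hb1
    exact ((QuotientGroup.eq_one_iff _).2 (h1 ▸ ⟨hh₀, hmem⟩)).symm
  · rw [le_sectionCentralizer_iff, commutator_comm, ← le_sectionCentralizer_iff]
    exact inf_eq_left.1 h1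

end ChiefFactors

/-! ### The product of the nilpotent groups with a formation -/

namespace GroupClass

theorem mem_prod_of_residual_le {X L : GroupClass.{u}} (hX : X.IsVariety) {G : Type u} [Group G]
    [Finite G] (N : Subgroup G) (hN : L.residual G ≤ N) (h : X.Mem N) : (X.prod L).Mem G :=
  hX.mem_of_le hN h

theorem pGroups_prod_subclass_nilpotent_prod (L : GroupClass.{u}) (p : ℕ) [Fact p.Prime] :
    ((pGroups p).prod L).Subclass (nilpotent.prod L) :=
  fun _ _ _ h => IsPGroup.isNilpotent (p := p) h

/-- `N_p L` is closed under extensions by normal `p`-subgroups. -/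
theorem pGroups_prod_of_quotient {L : GroupClass.{u}} {p : ℕ} {G : Type u} [Group G] [Finite G]
    (N : Subgroup G) [N.Normal] (hN : IsPGroup p N) (h : ((pGroups p).prod L).Mem (G ⧸ N)) :
    ((pGroups p).prod L).Mem G := by
  have h1 := IsPGroup.comap_of_ker_isPGroup (p := p) h (QuotientGroup.mk' N)
    (by rwa [QuotientGroup.ker_mk'])
  exact h1.to_le (map_le_iff_le_comap.1
    (L.map_residual_le_of_surjective _ (QuotientGroup.mk'_surjective N)))

theorem isPGroup_pRadical (p : ℕ) (G : Type u) [Group G] : IsPGroup p (pRadical p G) :=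
  Sylow.sSup_of_normal _ (fun _ h => h.2) fun _ h => h.1

/-- The canonical local satellite of `N L` sends `p` to `N_p L`. -/
theorem isCanonicalLocalSatellite_nilpotent_prod {L : GroupClass.{u}} (hL : L.IsFormation)
    (hne : L.IsNonempty) :
    IsCanonicalLocalSatellite (fun p : Nat.Primes => (pGroups p).prod L) (nilpotent.prod L) where
  isFormation p := (isVariety_pGroups p).isFormation_prod hL hne
  mem_iff G _ _ := by
    refine ⟨fun h H K _ _ hHK p _ => ?_, fun h => ?_⟩
    · have h1 : L.residual G ≤ sectionCentralizer H K :=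
        hHK.le_sectionCentralizer_of_isNilpotent h
      have h3 : L.residual (G ⧸ sectionCentralizer H K) = ⊥ := by
        rw [← hL.map_residual_eq hne _ (QuotientGroup.mk'_surjective _)]
        exact (Subgroup.map_eq_bot_iff _).2 (by rwa [QuotientGroup.ker_mk'])
      change IsPGroup p (L.residual (G ⧸ sectionCentralizer H K))
      rw [h3]
      exact IsPGroup.of_bot
    · refine isNilpotent_of_forall_isChiefFactor _ fun H K hHK _ => ?_
      have := hHK.normal_top
      have := hHK.normal_bot
      obtain ⟨p, hp, hdvd⟩ := Nat.exists_prime_and_dvd (n := K.relIndex H) fun h1 =>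
        hHK.lt.not_ge (relIndex_eq_one.1 h1)
      have := Fact.mk hp
      rw [commutator_comm, ← le_sectionCentralizer_iff]
      refine hHK.le_sectionCentralizer_of_pow_mem hdvd fun x hx => ?_
      have h1 : IsPGroup p (L.residual (G ⧸ sectionCentralizer H K)) := h H K hHK ⟨p, hp⟩ hdvd
      obtain ⟨k, hk⟩ := h1 ⟨(x : G ⧸ sectionCentralizer H K), L.map_residual_le_of_surjective _
        (QuotientGroup.mk'_surjective _) (mem_map_of_mem _ hx)⟩
      exact ⟨k, (QuotientGroup.eq_one_iff _).1 (congrArg Subtype.val hk)⟩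
  integrated p := by
    have := Fact.mk p.2
    exact pGroups_prod_subclass_nilpotent_prod L p
  full p G _ _ h := pGroups_prod_of_quotient _ (isPGroup_pRadical p G) h

end GroupClass

/-- A normal subgroup that is nilpotent modulo the Frattini subgroup is nilpotent. -/
theorem isNilpotent_of_map_frattini {G : Type*} [Group G] [Finite G] (N : Subgroup G) [N.Normal]
    (h : Group.IsNilpotent (N.map (QuotientGroup.mk' (frattini G)))) : Group.IsNilpotent N := by
  refine (Group.isNilpotent_of_finite_tfae (G := N)).out 3 0 |>.1 fun p hp P => ?_
  have := hp
  let f := QuotientGroup.mk' (frattini G)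
  let P' : Subgroup G := P.map N.subtype
  have hP'N : P' ≤ N := map_subtype_le _
  have hchar : (P.map (f.subgroupMap N)).Characteristic := by
    have hs := f.subgroupMap_surjective N
    have : (P.mapSurjective hs).Normal := inferInstance
    exact (P.mapSurjective hs).characteristic_of_normal this
  have hNn : (N.map f).Normal := Normal.map inferInstance _ (QuotientGroup.mk'_surjective _)
  have hn : (P'.map f).Normal := by
    have h1 : P'.map f = (P.map (f.subgroupMap N)).map (N.map f).subtype := by
      rw [map_map, map_map]
      rfl
    rw [h1]
    infer_instance
  have hT : (P' ⊔ frattini G).Normal := by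
    have h1 : (P'.map f).comap f = P' ⊔ frattini G := by
      rw [comap_map_eq, QuotientGroup.ker_mk']
    exact h1 ▸ inferInstance
  -- Intersecting with N keeps P a Sylow subgroup of T, as the Frattini argument requires; T remains
  -- normal and inside PΦ(G), so N_G(P)Φ(G) = G.
  let T : Subgroup G := (P' ⊔ frattini G) ⊓ N
  have hP'T : P' ≤ T := le_inf le_sup_left hP'N
  have hidx : ¬ p ∣ (P'.subgroupOf T).index := by
    intro hd
    refine P.not_dvd_index (hd.trans ?_)
    have h2 : P'.relIndex N = P.index := by
      change (P'.subgroupOf N).index = _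
      congr 1
      exact comap_map_eq_self_of_injective N.subtype_injective _
    rw [← h2, ← relIndex_mul_relIndex P' T N hP'T inf_le_right]
    exact dvd_mul_right _ _
  have hpg : IsPGroup p (P'.subgroupOf T) :=
    (P.isPGroup'.map N.subtype).comap_of_injective T.subtype T.subtype_injective
  have hfr := Sylow.normalizer_sup_eq_top (hpg.toSylow hidx)
  have h3 : ((hpg.toSylow hidx : Sylow p T) : Subgroup T).map T.subtype = P' := by
    rw [IsPGroup.toSylow_coe, map_subgroupOf_eq_of_le hP'T]
  rw [h3] at hfr
  have h4 : normalizer (P' : Set G) ⊔ frattini G = ⊤ := by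
    rw [eq_top_iff, ← hfr]
    exact sup_le le_sup_left (inf_le_left.trans (sup_le_sup_right le_normalizer _))
  have h5 : P'.Normal := normalizer_eq_top_iff.1 (frattini_nongenerating h4)
  exact h5.of_map_subtype

theorem GroupClass.isSaturated_nilpotent_prod {L : GroupClass.{u}} (hL : L.IsFormation)
    (hne : L.IsNonempty) : (nilpotent.prod L).IsSaturated := by
  intro G _ _ h
  refine isNilpotent_of_map_frattini (L.residual G) ?_
  rw [hL.map_residual_eq hne _ (QuotientGroup.mk'_surjective _)]
  exact h

/-! ### Coprime action -/

section Coprime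

variable {G : Type*} [Group G]

theorem exists_pow_orderOf_coprime [Finite G] (p : ℕ) [hp : Fact p.Prime] (x : G) :
    ∃ k, (orderOf (x ^ p ^ k)).Coprime p := by
  obtain ⟨k, m, hm, h⟩ := Nat.exists_eq_pow_mul_and_not_dvd (orderOf_pos x).ne' p hp.out.ne_one
  refine ⟨k, ?_⟩
  rw [orderOf_pow, h, Nat.gcd_eq_right (dvd_mul_right _ _),
    Nat.mul_div_cancel_left _ (pow_pos hp.out.pos k)]
  exact ((Nat.Prime.coprime_iff_not_dvd hp.out).2 hm).symm

theorem IsPGroup.eq_one_of_orderOf_coprime {p : ℕ} (hG : IsPGroup p G) {x : G}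
    (hx : (orderOf x).Coprime p) : x = 1 := by
  obtain ⟨k, hk⟩ := hG x
  rw [← orderOf_eq_one_iff]
  exact Nat.eq_one_of_dvd_coprimes (hx.pow_right k) dvd_rfl (orderOf_dvd_of_pow_eq_one hk)

/-- Conjugating d by x^m multiplies it by [x,d]^m, so the order of [x,d] divides both the order of x
and n. -/
theorem commute_of_commute_commutator {x d : G} {n : ℕ} (hx : (orderOf x).Coprime n)
    (hc : Commute x ⁅x, d⁆) (hn : ⁅x, d⁆ ^ n = 1) : Commute x d := by
  have key : ∀ m : ℕ, x ^ m * d * (x ^ m)⁻¹ = ⁅x, d⁆ ^ m * d := fun m => by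
    induction m with
    | zero => simp
    | succ m ih =>
      calc x ^ (m + 1) * d * (x ^ (m + 1))⁻¹ = x * (x ^ m * d * (x ^ m)⁻¹) * x⁻¹ := by
            rw [pow_succ']; group
        _ = (x * ⁅x, d⁆ ^ m) * (d * x⁻¹) := by rw [ih]; group
        _ = ⁅x, d⁆ ^ m * (x * d * x⁻¹ * d⁻¹) * d := by rw [(hc.pow_right m).eq]; group
        _ = ⁅x, d⁆ ^ (m + 1) * d := by rw [pow_succ]; rfl
  have h1 := key (orderOf x)
  rw [pow_orderOf_eq_one, one_mul, inv_one, mul_one, right_eq_mul] at h1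
  rw [← commutatorElement_eq_one_iff_commute, ← orderOf_eq_one_iff]
  exact Nat.eq_one_of_dvd_coprimes hx (orderOf_dvd_of_pow_eq_one h1) (orderOf_dvd_of_pow_eq_one hn)

/-- An element of order prime to `p` centralizing every chief factor below a normal `p`-subgroup
centralizes this subgroup. -/
theorem commute_of_mem_sectionCentralizer [Finite G] {p : ℕ} {N : Subgroup G} [N.Normal]
    (hN : IsPGroup p N) {x : G} (hx : (orderOf x).Coprime p)
    (h : ∀ (H K : Subgroup G) [K.Normal], IsChiefFactor H K → H ≤ N → x ∈ sectionCentralizer H K)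
    {d : G} (hd : d ∈ N) : Commute x d := by
  have key : ∀ (m : ℕ) (H : Subgroup G), H.Normal → H ≤ N → Nat.card H ≤ m →
      ∀ d ∈ H, Commute x d := by
    intro m
    induction m with
    | zero => exact fun H _ _ h0 => absurd Nat.card_pos h0.not_gt
    | succ m ih =>
      intro H hHn hHN hcard d hd
      by_cases hb : H = ⊥
      · rw [hb, mem_bot] at hd
        exact hd ▸ Commute.one_right x
      obtain ⟨K, hK⟩ := exists_isChiefFactor H hb
      have := hK.normal_bot
      have hlt : Nat.card K < Nat.card H := Set.ncard_lt_ncard (SetLike.coe_ssubset_coe.2 hK.lt)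
      -- Acting trivially on H/K puts the commutator in K, which x centralizes by induction.
      have hmem : ⁅x, d⁆ ∈ K := mem_sectionCentralizer.1 (h H K hK hHN) d hd
      obtain ⟨k, hk⟩ := hN ⟨_, hHN (hK.lt.le hmem)⟩
      exact commute_of_commute_commutator (hx.pow_right k)
        (ih K hK.normal_bot (hK.lt.le.trans hHN) (by omega) _ hmem) (congrArg Subtype.val hk)
  exact key _ N inferInstance le_rfl le_rfl d hd

/-- All chief factors of a nilpotent group are central, so the preceding lemma applies to the normal
Sylow subgroup containing d. -/
theorem Group.IsNilpotent.commute_of_coprime [Finite G] [Group.IsNilpotent G] {p k : ℕ}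
    [Fact p.Prime] {x d : G} (hx : (orderOf x).Coprime p) (hd : d ^ p ^ k = 1) : Commute x d := by
  have hz : IsPGroup p (zpowers d) := by
    rintro ⟨_, n, rfl⟩
    exact ⟨k, Subtype.ext (by
      change (d ^ n) ^ p ^ k = 1
      rw [← zpow_natCast, ← zpow_mul, mul_comm, zpow_mul, zpow_natCast, hd, one_zpow])⟩
  obtain ⟨P, hP⟩ := hz.exists_le_sylow
  refine commute_of_mem_sectionCentralizer (N := P) P.isPGroup' hx (fun H K _ hHK _ => ?_)
    (hP (mem_zpowers d))
  exact hHK.le_sectionCentralizer_of_isNilpotent (R := ⊤) (Group.isNilpotent_top.2 ‹_›)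
    (mem_top x)

end Coprime

/-! ### Minimal counterexamples -/

theorem commutator_lt_of_isSolvable {G : Type*} [Group G] {H : Subgroup G}
    (h : Group.IsSolvable H) (hne : H ≠ ⊥) : ⁅H, H⁆ < H := by
  rw [← nontrivial_iff_ne_bot] at hne
  rw [← map_subtype_commutator]
  conv_rhs => rw [← H.range_subtype, MonoidHom.range_eq_map]
  rw [map_subtype_lt_map_subtype]
  exact Group.IsSolvable.commutator_lt_top_of_nontrivial H

/-- A soluble minimal normal subgroup of a group that does not belong to the saturated formation
`F`, while all its proper quotients do. -/
theorem GroupClass.IsFormation.exists_isPGroup_centralizer_le {F : GroupClass.{u}}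
    (hF : F.IsFormation) (hsat : F.IsSaturated) (hne : F.IsNonempty) {G : Type u} [Group G]
    [Finite G] (hG : ¬ F.Mem G) (hq : ∀ (A : Subgroup G) [A.Normal], A ≠ ⊥ → F.Mem (G ⧸ A))
    {N : Subgroup G} (hN : IsChiefFactor N ⊥) (hsol : Group.IsSolvable N) :
    ∃ q : ℕ, q.Prime ∧ IsPGroup q N ∧ centralizer (N : Set G) ≤ N ∧
      ∃ M : Subgroup G, M ≠ ⊤ ∧ M ⊔ N = ⊤ := by
  have hNn := hN.normal_top
  have hNb : N ≠ ⊥ := hN.lt.ne'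
  have hmin : ∀ A : Subgroup G, A.Normal → A ≠ ⊥ → N ≤ A := by
    intro A hA hAb
    -- If N ∩ A were trivial, the residual, lying in both, would be trivial and G would belong to
    -- `F`.
    rcases hN.eq_or_eq (N ⊓ A) inferInstance bot_le inf_le_left with h | h
    · refine absurd (hF.mem_of_residual_eq_bot hne ?_) hG
      rw [← le_bot_iff, ← h]
      exact le_inf (F.residual_le N (hq N hNb)) (F.residual_le A (hq A hAb))
    · exact inf_eq_left.1 h
  have hPhi : frattini G = ⊥ := by
    by_contra h
    exact hG (hsat G (hq _ h))
  have hab : ⁅N, N⁆ = ⊥ := by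
    have hlt := commutator_lt_of_isSolvable hsol hNb
    exact (hN.eq_or_eq _ inferInstance bot_le hlt.le).resolve_right hlt.ne
  have hNC : N ≤ centralizer (N : Set G) := commutator_eq_bot_iff_le_centralizer.1 hab
  have hnil : Group.IsNilpotent N := (isNilpotent_iff_lowerCentralSeries N).2 ⟨1, hab⟩
  obtain ⟨q, hqp, hdvd⟩ := Nat.exists_prime_and_dvd (n := Nat.card N)
    fun h => hNb (card_eq_one.1 h)
  have := Fact.mk hqp
  obtain ⟨M, hM, hNM⟩ : ∃ M : Subgroup G, IsCoatom M ∧ ¬ N ≤ M := by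
    by_contra! h
    exact hNb (le_bot_iff.1 (hPhi ▸ le_iInf₂ h))
  have hMN : M ⊔ N = ⊤ := hM.2 _ (left_lt_sup.2 hNM)
  refine ⟨q, hqp, ?_, ?_, M, hM.1, hMN⟩
  · let P : Sylow q N := default
    have hch : (P : Subgroup N).Characteristic := P.characteristic_of_normal inferInstance
    have hle : N ≤ P.map N.subtype := by
      refine hmin _ inferInstance fun h => P.ne_bot_of_dvd_card hdvd ?_
      exact (map_eq_bot_iff_of_injective _ N.subtype_injective).1 h
    exact (P.isPGroup'.map N.subtype).to_le hle
  · let C : Subgroup G := centralizer (N : Set G)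
    -- M normalizes M ∩ C because C is normal, and N centralizes it; together they generate G.
    have hMC : (M ⊓ C).Normal := by
      rw [← normalizer_eq_top_iff, eq_top_iff, ← hMN]
      refine sup_le ?_ ?_ <;> rw [le_normalizer_iff_commutator_le_right]
      · exact le_inf ((commutator_mono le_rfl inf_le_left).trans M.commutator_le_self)
          ((commutator_mono le_rfl inf_le_right).trans (commutator_le_right M C))
      · refine (commutator_mono le_rfl inf_le_right).trans ?_
        rw [commutator_comm, commutator_eq_bot_iff_le_centralizer.2 le_rfl]
        exact bot_le
    have hbot : M ⊓ C = ⊥ := by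
      by_contra h
      exact hNM ((hmin _ hMC h).trans inf_le_left)
    intro c hc
    obtain ⟨m, hm, n, hn, rfl⟩ := mem_sup_of_normal_right.1 (hMN ▸ mem_top c : c ∈ M ⊔ N)
    have hm1 : m ∈ M ⊓ C := ⟨hm, (C.mul_mem_cancel_right (hNC hn)).1 hc⟩
    rw [hbot, mem_bot] at hm1
    rwa [hm1, one_mul]

/-! ### Fusion and transfer -/

section Fusion

variable {G : Type*} [Group G] [Finite G] {q : ℕ} [Fact q.Prime]

/-- If the elements of order prime to `q` normalizing `D` centralize it, then each element
normalizing `D` is a product of an element centralizing `D` and one of a given Sylow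
`q`-subgroup of the normalizer. -/
theorem exists_mul_of_mem_normalizer {D : Subgroup G}
    (h : ∀ x ∈ normalizer (D : Set G), (orderOf x).Coprime q → ∀ d ∈ D, Commute x d)
    (S : Sylow q (normalizer (D : Set G))) (g : normalizer (D : Set G)) :
    ∃ c : normalizer (D : Set G), (c : G) ∈ centralizer (D : Set G) ∧ ∃ s ∈ S, g = c * s := by
  let C : Subgroup (normalizer (D : Set G)) :=
    (centralizer (D : Set G)).subgroupOf (normalizer (D : Set G))
  have hCn : C.Normal := normal_subgroupOf_centralizer_normalizer _
  -- The q'-part of every element of the normalizer lies in C, so the quotient is a q-group and is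
  -- covered by any Sylow q-subgroup.
  have hpg : IsPGroup q (normalizer (D : Set G) ⧸ C) := by
    intro y
    obtain ⟨x, rfl⟩ := QuotientGroup.mk_surjective y
    obtain ⟨k, hk⟩ := exists_pow_orderOf_coprime q x
    refine ⟨k, (QuotientGroup.eq_one_iff _).2 (mem_subgroupOf.2 (mem_centralizer_iff.2 ?_))⟩
    intro d hd
    exact (h _ (x ^ q ^ k).2 (by rwa [orderOf_coe]) d hd).symm
  have htop : S.map (QuotientGroup.mk' C) = ⊤ := by
    have := (S.mapSurjective (QuotientGroup.mk'_surjective C)).3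
      (hpg.to_subgroup ⊤) le_top
    exact this.symm
  obtain ⟨s, hs, hsg⟩ : (g : normalizer (D : Set G) ⧸ C) ∈ S.map (QuotientGroup.mk' C) :=
    htop ▸ mem_top _
  have hmem : g * s⁻¹ ∈ C := by
    rw [← QuotientGroup.eq_one_iff, QuotientGroup.mk_mul, QuotientGroup.mk_inv, ← hsg]
    exact mul_inv_cancel _
  exact ⟨g * s⁻¹, hmem, s, hs, by group⟩

/-- Normalizers grow in the nilpotent group S. -/
theorem IsPGroup.exists_mem_normalizer_of_lt {D S : Subgroup G} (hS : IsPGroup q S)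
    (hlt : D < S) : D < normalizer (D : Set G) ⊓ S := by
  have := hS.isNilpotent
  have h1 := Group.normalizerCondition_of_isNilpotent (G := S) (D.subgroupOf S)
    (lt_top_iff_ne_top.2 fun h => hlt.not_ge (subgroupOf_eq_top.1 h))
  rw [← subgroupOf_normalizer_eq hlt.le] at h1
  obtain ⟨x, hx, hxD⟩ := SetLike.exists_of_lt h1
  exact lt_of_le_of_ne (le_inf le_normalizer hlt.le) fun h =>
    hxD (mem_subgroupOf.2 (h ▸ ⟨mem_subgroupOf.1 hx, x.2⟩))

/-- Two Sylow `q`-subgroups are conjugate under the centralizer of their intersection, if the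
elements of order prime to `q` normalizing a non-trivial `q`-subgroup centralize it. -/
theorem Sylow.exists_mem_centralizer_smul_eq
    (h : ∀ D : Subgroup G, D ≠ ⊥ → IsPGroup q D → ∀ x ∈ normalizer (D : Set G),
      (orderOf x).Coprime q → ∀ d ∈ D, Commute x d) (S T : Sylow q G) :
    ∃ c ∈ centralizer ((S ⊓ T : Subgroup G) : Set G), c • S = T := by
  -- Downward induction on the size of the intersection.
  induction hm : Nat.card G - Nat.card (S ⊓ T : Subgroup G) using Nat.strong_induction_on
    generalizing S T with
  | _ m ih =>
  by_cases hST : S = T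
  · exact ⟨1, one_mem _, by rw [one_smul, hST]⟩
  let D : Subgroup G := S ⊓ T
  by_cases hD : D = ⊥
  · obtain ⟨g, hg⟩ := MulAction.exists_smul_eq G S T
    refine ⟨g, ?_, hg⟩
    change g ∈ centralizer (D : Set G)
    rw [hD, mem_centralizer_iff]
    rintro x rfl
    simp
  have ih' : ∀ A B : Sylow q G, D < (A ⊓ B : Subgroup G) → ∃ c ∈ centralizer (D : Set G), c • A = B := by
    intro A B hAB
    have h1 : Nat.card D < Nat.card (A ⊓ B : Subgroup G) :=
      Set.ncard_lt_ncard (SetLike.coe_ssubset_coe.2 hAB)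
    have h2 := card_le_card_group (A ⊓ B : Subgroup G)
    obtain ⟨c, hc, hcA⟩ := ih _ (by
      rw [← hm]
      change _ < Nat.card G - Nat.card D
      omega) A B rfl
    exact ⟨c, centralizer_le hAB.le hc, hcA⟩
  have hDS : D < S := lt_of_le_of_ne inf_le_left fun h =>
    hST (Sylow.ext (S.3 T.2 (inf_eq_left.1 h)).symm)
  have hDT : D < T := lt_of_le_of_ne inf_le_right fun h =>
    hST (Sylow.ext (T.3 S.2 (inf_eq_right.1 h)))
  have hDp : IsPGroup q D := S.2.to_le inf_le_left
  let N : Subgroup G := normalizer (D : Set G)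
  obtain ⟨S₁, hS₁⟩ := (S.2.comap_of_injective N.subtype N.subtype_injective).exists_le_sylow
  obtain ⟨T₁, hT₁⟩ := (T.2.comap_of_injective N.subtype N.subtype_injective).exists_le_sylow
  obtain ⟨g, hg⟩ := MulAction.exists_smul_eq N S₁ T₁
  obtain ⟨c, hc, s, hs, rfl⟩ := exists_mul_of_mem_normalizer (h D hD hDp) S₁ g
  have hcS : c • S₁ = T₁ := by
    rw [mul_smul, Sylow.smul_eq_iff_mem_normalizer.2 (le_normalizer hs)] at hg
    exact hg
  -- U contains N_S(D) and its conjugate by c contains N_T(D). By normalizer growth S ∩ U and cU ∩ T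
  -- properly contain D, so induction links S to U and cU to T by elements centralizing D.
  obtain ⟨U, hU⟩ := (S₁.2.map N.subtype).exists_le_sylow
  have hSU : D < (S ⊓ U : Subgroup G) := (S.2.exists_mem_normalizer_of_lt hDS).trans_le
    (le_inf inf_le_right fun x hx => hU ⟨⟨x, hx.1⟩, hS₁ hx.2, rfl⟩)
  have hVT : D < (((c : G) • U : Sylow q G) ⊓ T : Subgroup G) := by
    refine (T.2.exists_mem_normalizer_of_lt hDT).trans_le (le_inf (fun x hx => ?_) inf_le_right)
    have h1 : (⟨x, hx.1⟩ : N) ∈ c • S₁ := hcS ▸ hT₁ hx.2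
    obtain ⟨y, hy, hyx⟩ := h1
    refine ⟨y, hU ⟨y, hy, rfl⟩, ?_⟩
    exact congrArg Subtype.val hyx
  obtain ⟨x, hx, hxS⟩ := ih' _ _ hSU
  obtain ⟨y, hy, hyT⟩ := ih' _ _ hVT
  refine ⟨y * c * x, mul_mem (mul_mem hy hc) hx, ?_⟩
  rw [mul_smul, mul_smul, hxS, hyT]

/-- If the elements of order prime to `q` normalizing a non-trivial `q`-subgroup centralize it,
then the group is not perfect, provided that `q` divides its order. -/
theorem commutator_ne_top_of_forall_commute
    (h : ∀ D : Subgroup G, D ≠ ⊥ → IsPGroup q D → ∀ x ∈ normalizer (D : Set G),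
      (orderOf x).Coprime q → ∀ d ∈ D, Commute x d) (hq : q ∣ Nat.card G) :
    _root_.commutator G ≠ ⊤ := by
  intro htop
  let P : Sylow q G := default
  have hPb : (P : Subgroup G) ≠ ⊥ := P.ne_bot_of_dvd_card hq
  have hnil := P.2.isNilpotent
  -- By the focal subgroup theorem P ∩ G′ is generated by the commutators [x,u] in P with x ∈ P.
  -- Each is shown to lie in P′, so perfectness would give P = P′.
  have hfoc := commutator_inf_eq_focalSubgroup P
  rw [htop, top_inf_eq] at hfoc
  refine (commutator_lt_of_isSolvable (H := (P : Subgroup G)) inferInstance hPb).not_ge ?_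
  conv_lhs => rw [hfoc, focalSubgroup_def]
  rw [closure_le]
  rintro _ ⟨hg, x, hx, u, rfl⟩
  have hy : u * x⁻¹ * u⁻¹ ∈ P := by
    have : u * x⁻¹ * u⁻¹ = x⁻¹ * ⁅x, u⁆ := by rw [commutatorElement_def]; group
    rw [this]
    exact mul_mem (inv_mem hx) hg
  -- The conjugate of x⁻¹ by u lies in uP ∩ P, so c centralizes it while cu normalizes P. Writing cu
  -- = as with a centralizing P and s ∈ P, u can be replaced by s in the commutator.
  obtain ⟨c, hc, hcP⟩ := Sylow.exists_mem_centralizer_smul_eq h (u • P) P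
  have hcy := mem_centralizer_iff.1 hc (u * x⁻¹ * u⁻¹) ⟨⟨x⁻¹, inv_mem hx, rfl⟩, hy⟩
  rw [← mul_smul, Sylow.smul_eq_iff_mem_normalizer] at hcP
  obtain ⟨a, ha, s, hs, has⟩ := exists_mul_of_mem_normalizer (h P hPb P.2)
    (P.subtype le_normalizer) ⟨c * u, hcP⟩
  have hs' : (s : G) ∈ P := hs
  have hcu : c * u = a * s := congrArg Subtype.val has
  have has' := mem_centralizer_iff.1 ha (s * x⁻¹ * (s : G)⁻¹)
    (mul_mem (mul_mem hs' (inv_mem hx)) (inv_mem hs'))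
  have key : u * x⁻¹ * u⁻¹ = s * x⁻¹ * (s : G)⁻¹ := by
    calc u * x⁻¹ * u⁻¹ = u * x⁻¹ * u⁻¹ * c * c⁻¹ := by group
      _ = (c * u) * x⁻¹ * (c * u)⁻¹ := by rw [hcy]; group
      _ = a * (s * x⁻¹ * (s : G)⁻¹) * (a : G)⁻¹ := by rw [hcu]; group
      _ = s * x⁻¹ * (s : G)⁻¹ := by rw [← has']; group
  have : ⁅x, u⁆ = ⁅x, (s : G)⁆ := by
    rw [commutatorElement_def, commutatorElement_def, mul_assoc x u, mul_assoc x, key]; group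
  rw [this]
  exact commutator_mem_commutator hx hs'

end Fusion

/-- A simple group whose proper subgroups are extensions of `p`-groups by nilpotent groups is
soluble. -/
theorem isSolvable_of_forall_extension {G : Type*} [Group G] [Finite G] [IsSimpleGroup G]
    {p : ℕ} [hp : Fact p.Prime]
    (h : ∀ M : Subgroup G, M ≠ ⊤ → ∃ (K : Subgroup M) (_ : K.Normal), IsPGroup p K ∧
      Group.IsNilpotent (M ⧸ K)) : Group.IsSolvable G := by
  by_cases hc : _root_.commutator G = ⊤
  swap
  · have h1 := (IsSimpleGroup.eq_bot_or_eq_top_of_normal (_root_.commutator G)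
      inferInstance).resolve_right hc
    rw [commutator_eq_bot_iff] at h1
    exact Group.isSolvable_of_comm h1.is_comm.comm
  by_contra hns
  have hpg : IsPGroup p G := by
    rw [isPGroup_iff_primeFactors_card_subset hp.out.ne_zero, hp.out.primeFactors]
    intro q hq
    by_contra hqp
    rw [Finset.mem_singleton] at hqp
    have hq' := Fact.mk (Nat.prime_of_mem_primeFactors hq)
    refine commutator_ne_top_of_forall_commute (q := q) (fun D hD hDq x hx hxq d hd => ?_)
      (Nat.dvd_of_mem_primeFactors hq) hc
    have hM : normalizer (D : Set G) ≠ ⊤ := by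
      intro hM
      have hDn := normalizer_eq_top_iff.1 hM
      have hDt := hDn.eq_bot_or_eq_top.resolve_left hD
      rw [hDt] at hDq
      have := (hDq.of_equiv topEquiv).isNilpotent
      exact hns inferInstance
    obtain ⟨K, hK, hKp, hKn⟩ := h _ hM
    let x' : normalizer (D : Set G) := ⟨x, hx⟩
    let d' : normalizer (D : Set G) := ⟨d, le_normalizer hd⟩
    obtain ⟨k, hk⟩ := hDq ⟨d, hd⟩
    have hdk : d' ^ q ^ k = 1 := Subtype.ext (by
      change d ^ q ^ k = 1
      exact congrArg Subtype.val hk)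
    have hcomm : Commute (QuotientGroup.mk' K x') (QuotientGroup.mk' K d') := by
      refine Group.IsNilpotent.commute_of_coprime (p := q) (k := k) ?_ ?_
      · refine Nat.Coprime.coprime_dvd_left (orderOf_map_dvd _ _) ?_
        rwa [← orderOf_coe]
      · rw [← map_pow, hdk, map_one]
    rw [← commutatorElement_eq_one_iff_commute, ← map_commutatorElement, QuotientGroup.mk'_apply,
      QuotientGroup.eq_one_iff] at hcomm
    have hxd : ⁅x, d⁆ ∈ D := by
      rw [commutatorElement_def]
      exact mul_mem ((mem_normalizer_iff.1 hx d).1 hd) (inv_mem hd)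
    -- The commutator lies in the q-group D and, since the quotient by K is nilpotent, in the
    -- p-group K.
    have hdisj := IsPGroup.disjoint_of_ne q p hqp D (K.map (normalizer (D : Set G)).subtype) hDq
      (hKp.map _)
    rw [← commutatorElement_eq_one_iff_commute, ← mem_bot, ← hdisj.eq_bot]
    exact ⟨hxd, ⟨_, hcomm, rfl⟩⟩
  have := hpg.isNilpotent
  exact hns inferInstance

/-! ### The boundary condition -/

namespace GroupClass

theorem exists_isChiefFactor_bot {G : Type*} [Group G] [Finite G] [Nontrivial G] :
    ∃ N : Subgroup G, IsChiefFactor N ⊥ := by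
  let S : Set (Subgroup G) := {N | N.Normal ∧ N ≠ ⊥}
  obtain ⟨N, hN⟩ := S.toFinite.exists_minimal ⟨⊤, inferInstance, top_ne_bot⟩
  refine ⟨N, hN.1.1, inferInstance, bot_lt_iff_ne_bot.2 hN.1.2, fun A hA _ hAN => ?_⟩
  by_cases h : A = ⊥
  · exact Or.inl h
  · exact Or.inr (le_antisymm hAN (hN.2 ⟨hA, h⟩ hAN))

/-- Proper subgroups of a quotient are images of proper subgroups, so properties of the latter are
inherited. -/
theorem exists_subgroup_surjective {G H : Type*} [Group G] [Group H] (f : G →* H)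
    (hf : Function.Surjective f) {S : Subgroup H} (hS : S ≠ ⊤) :
    S.comap f ≠ ⊤ ∧ Function.Surjective (f.subgroupComap S) :=
  ⟨fun h => hS (comap_injective hf (h.trans (comap_top f).symm)),
    f.subgroupComap_surjective_of_surjective S hf⟩

/-- To show that the `N_p L`-critical groups of a quotient-closed class belong to `N L`, it
suffices to consider those all of whose proper quotients belong to `N L`. -/
theorem mem_nilpotent_prod_of_isCritical {L Y : GroupClass.{u}} (hL : L.IsFormation)
    (hne : L.IsNonempty) (p : ℕ) [Fact p.Prime]
    (hY : ∀ (G : Type u) [Group G] [Finite G] (A : Subgroup G) [A.Normal], Y.Mem G → Y.Mem (G ⧸ A))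
    (hstep : ∀ (G : Type u) [Group G] [Finite G], Y.Mem G → ((pGroups p).prod L).IsCritical G →
      (∀ (A : Subgroup G) [A.Normal], A ≠ ⊥ → (nilpotent.prod L).Mem (G ⧸ A)) →
      (nilpotent.prod L).Mem G)
    (G : Type u) [Group G] [Finite G] (hGY : Y.Mem G) (hG : ((pGroups p).prod L).IsCritical G) :
    (nilpotent.prod L).Mem G := by
  have hF := (isVariety_pGroups.{u} p).isFormation_prod hL hne
  induction hm : Nat.card G using Nat.strong_induction_on generalizing G with
  | _ m ih =>
  refine hstep G hGY hG fun A _ hA => ?_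
  by_cases hmem : ((pGroups p).prod L).Mem (G ⧸ A)
  · exact pGroups_prod_subclass_nilpotent_prod L p _ hmem
  refine ih _ ?_ (G ⧸ A) (hY G A hGY) ⟨hmem, fun S hS => ?_⟩ rfl
  · rw [← hm, card_eq_card_quotient_mul_card_subgroup A]
    exact lt_mul_of_one_lt_right Nat.card_pos (one_lt_card_iff_ne_bot A |>.2 hA)
  · obtain ⟨h1, h2⟩ := exists_subgroup_surjective _ (QuotientGroup.mk'_surjective A) hS
    exact hF.of_surjective _ h2 (hG.2 _ h1)

/-- The structure of an `N_p L`-critical group outside `N L` with all proper quotients in `N L`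
and with a soluble minimal normal subgroup. -/
theorem exists_isPGroup_of_isCritical {L : GroupClass.{u}} (hL : L.IsFormation)
    (hne : L.IsNonempty) {p : ℕ} [Fact p.Prime] {G : Type u} [Group G] [Finite G]
    (hG : ((pGroups p).prod L).IsCritical G) (hGF : ¬ (nilpotent.prod L).Mem G)
    (hq : ∀ (A : Subgroup G) [A.Normal], A ≠ ⊥ → (nilpotent.prod L).Mem (G ⧸ A))
    {N : Subgroup G} [N.Normal] (hN : IsChiefFactor N ⊥) (hsol : Group.IsSolvable N) :
    ∃ q : ℕ, q.Prime ∧ IsPGroup q N ∧ centralizer (N : Set G) ≤ N ∧ ¬ L.Mem (G ⧸ N) ∧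
      ∀ T : Subgroup G, N ≤ T → T ≠ ⊤ → L.Mem T := by
  have hpF := (isVariety_pGroups.{u} p).isFormation_prod hL hne
  have hF := isVariety_nilpotent.{u}.isFormation_prod hL hne
  have hFne : (nilpotent.prod L).IsNonempty := ⟨_, _, _, hq N hN.lt.ne'⟩
  obtain ⟨q, hqp, hNq, hC, M, hM, hMN⟩ := hF.exists_isPGroup_centralizer_le
    (isSaturated_nilpotent_prod hL hne) hFne hGF hq hN hsol
  have := Fact.mk hqp
  refine ⟨q, hqp, hNq, hC, fun h => hGF ?_, fun T hNT hT => ?_⟩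
  · exact mem_prod_of_residual_le isVariety_nilpotent N (L.residual_le N h) hNq.isNilpotent
  · have hqne : p ≠ q := by
      rintro rfl
      refine hG.1 (pGroups_prod_of_quotient N hNq ?_)
      refine hpF.of_surjective ((QuotientGroup.mk' N).comp M.subtype) ?_ (hG.2 M hM)
      rw [← MonoidHom.range_eq_top, MonoidHom.range_comp, range_subtype]
      have h1 : (M ⊔ N).map (QuotientGroup.mk' N) = ⊤ := by
        rw [hMN, ← MonoidHom.range_eq_map, MonoidHom.range_eq_top]
        exact QuotientGroup.mk'_surjective N
      rwa [Subgroup.map_sup, (Subgroup.map_eq_bot_iff N).2 (QuotientGroup.ker_mk' N).ge,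
        sup_bot_eq] at h1
    have hR : IsPGroup p (L.residual T) := hG.2 T hT
    have hdisj : Disjoint (L.residual T) (N.subgroupOf T) :=
      IsPGroup.disjoint_of_ne p q hqne _ _ hR hNq.comap_subtype
    refine hL.mem_of_residual_eq_bot hne ?_
    rw [← le_bot_iff, ← hdisj.eq_bot]
    refine le_inf le_rfl fun x hx => hC (mem_centralizer_iff.2 fun n hn => ?_)
    have h1 := commutator_eq_bot_iff_le_centralizer.1 (commutator_eq_bot_of_disjoint hdisj)
    exact congrArg Subtype.val (mem_centralizer_iff.1 (h1 hx) ⟨n, hNT hn⟩ hn)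

/-- If a group `T` of the saturated formation `L` has a self-centralizing non-trivial normal
`q`-subgroup, then `T` belongs to the value at `q` of the canonical local satellite. -/
theorem IsCanonicalLocalSatellite.mem_of_centralizer_le {L : GroupClass.{u}}
    {l : Nat.Primes → GroupClass.{u}} (hl : IsCanonicalLocalSatellite l L) (q : Nat.Primes)
    {T : Type u} [Group T] [Finite T] (hT : L.Mem T) {N : Subgroup T} [N.Normal] (hNb : N ≠ ⊥)
    (hN : IsPGroup q N) (hC : centralizer (N : Set T) ≤ N) : (l q).Mem T := by
  have := Fact.mk q.2
  have hmem : ∀ (H K : Subgroup T) [H.Normal] [K.Normal], IsChiefFactor H K → H ≤ N →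
      (l q).Mem (T ⧸ sectionCentralizer H K) := by
    intro H K _ _ hHK hHN
    refine (hl.mem_iff T).1 hT H K hHK q ?_
    obtain ⟨n, hn⟩ := (hN.to_le hHN).index (K.subgroupOf H)
    rw [relIndex, hn]
    refine dvd_pow_self _ fun h0 => hHK.lt.not_ge ?_
    rw [h0, pow_zero] at hn
    exact relIndex_eq_one.1 hn
  have hne : (l q).IsNonempty := by
    obtain ⟨K, hK⟩ := exists_isChiefFactor N hNb
    have := hK.normal_bot
    exact ⟨_, _, _, hmem N K hK le_rfl⟩
  -- It suffices that the `l q`-residual is a q-group. It centralizes the chief factors below N, so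
  -- its q'-elements centralize N, lie in N, and are trivial.
  refine hl.full q T ((hl.isFormation q).quotient_mem_of_residual_le hne _
    (le_sSup ⟨inferInstance, ?_⟩))
  rintro ⟨x, hx⟩
  obtain ⟨k, hk⟩ := exists_pow_orderOf_coprime (q : ℕ) x
  refine ⟨k, Subtype.ext ?_⟩
  change x ^ (q : ℕ) ^ k = 1
  have hxN : x ^ (q : ℕ) ^ k ∈ N := hC (mem_centralizer_iff.2 fun n hn =>
    (commute_of_mem_sectionCentralizer hN hk (fun H K _ hHK hHN => by
      have := hHK.normal_top
      exact (l q).residual_le _ (hmem H K hHK hHN) (pow_mem hx _)) hn).symm)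
  exact congrArg Subtype.val
    (hN.eq_one_of_orderOf_coprime (x := ⟨_, hxN⟩) (by rwa [orderOf_mk]))

/-- A formation of nilpotent groups contains the groups of order `r` for each prime `r` dividing
the order of one of its members. -/
theorem IsFormation.mem_of_card_eq_prime {L : GroupClass.{u}} (hL : L.IsFormation)
    (hnil : L.Subclass nilpotent) {r : Nat.Primes} (hr : r ∈ L.primeSet) {H : Type u} [Group H]
    [Finite H] (hH : Nat.card H = r) : L.Mem H := by
  have := Fact.mk r.2
  obtain ⟨G, _, _, hG, hdvd⟩ := hr
  have hGn : Group.IsNilpotent G := hnil G hG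
  obtain ⟨e⟩ := ((Group.isNilpotent_of_finite_tfae (G := G)).out 0 4).1 hGn
  let P : Sylow r G := default
  have hPb : (P : Subgroup G) ≠ ⊥ := P.ne_bot_of_dvd_card hdvd
  let i : (Nat.card G).primeFactors :=
    ⟨r, Nat.mem_primeFactors.2 ⟨r.2, hdvd, Nat.card_pos.ne'⟩⟩
  -- The nilpotent group projects onto its Sylow factor; a subgroup of index r there is normal,
  -- which gives a quotient of order r.
  have hP : L.Mem (P : Subgroup G) := by
    let f : (∀ p : (Nat.card G).primeFactors, ∀ P : Sylow p G, (P : Subgroup G)) →*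
        (P : Subgroup G) :=
      (Pi.evalMonoidHom (fun Q : Sylow i G => (Q : Subgroup G)) P).comp
        (Pi.evalMonoidHom (fun p : (Nat.card G).primeFactors =>
          ∀ Q : Sylow p G, (Q : Subgroup G)) i)
    have hf : Function.Surjective f :=
      (Function.surjective_eval P).comp (Function.surjective_eval i)
    exact hL.of_surjective (f.comp e.symm.toMonoidHom) (hf.comp e.symm.surjective) hG
  obtain ⟨n, hn⟩ := IsPGroup.iff_card.1 P.isPGroup'
  obtain ⟨m, rfl⟩ := Nat.exists_eq_succ_of_ne_zero fun h0 : n = 0 =>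
    hPb (card_eq_one.1 (by rw [hn, h0, pow_zero]))
  obtain ⟨K, hK⟩ := Sylow.exists_subgroup_card_pow_prime (G := (P : Subgroup G)) (r : ℕ)
    (n := m) (hn ▸ pow_dvd_pow _ m.le_succ)
  have hidx : K.index = r := by
    have h1 := K.card_mul_index
    rw [hn, hK, pow_succ] at h1
    exact Nat.eq_of_mul_eq_mul_left (pow_pos r.2.pos m) h1
  have hKn : K.Normal := normal_of_index_eq_minFac_card (by
    rw [hidx, hn, r.2.pow_minFac m.succ_ne_zero])
  have h1 : L.Mem ((P : Subgroup G) ⧸ K) :=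
    hL.of_surjective (QuotientGroup.mk' K) (QuotientGroup.mk'_surjective K) hP
  exact L.mem_of_equiv (mulEquivOfPrimeCardEq (p := r) hidx hH) h1

theorem satisfiesBoundaryConditionIn_nilpotent_prod {L Y : GroupClass.{u}} (hL : L.IsFormation)
    (hne : L.IsNonempty)
    (h : ∀ (p : ℕ) [Fact p.Prime] (G : Type u) [Group G] [Finite G], Y.Mem G →
      ((pGroups p).prod L).IsCritical G → (nilpotent.prod L).Mem G) :
    (nilpotent.prod L).SatisfiesBoundaryConditionIn Set.univ Y := by
  refine ⟨isVariety_nilpotent.isFormation_prod hL hne, isSaturated_nilpotent_prod hL hne, _,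
    isCanonicalLocalSatellite_nilpotent_prod hL hne, fun G _ _ hG => ?_⟩
  rintro ⟨p, -, hp⟩
  have := Fact.mk p.2
  exact h p G hG hp

theorem exists_isChiefFactor_bot_of_not_mem {L : GroupClass.{u}} {G : Type u} [Group G] [Finite G]
    (hG : ¬ (nilpotent.prod L).Mem G) : ∃ N : Subgroup G, IsChiefFactor N ⊥ := by
  have : Nontrivial G := by
    by_contra h
    rw [not_nontrivial_iff_subsingleton] at h
    refine hG ?_
    change Group.IsNilpotent (L.residual G)
    infer_instance
  exact exists_isChiefFactor_bot

/-- If `L` satisfies the boundary condition in the class of soluble groups, so does `N L`. -/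
theorem nilpotent_prod_boundary_soluble {L : GroupClass.{u}}
    (h : L.SatisfiesBoundaryConditionIn Set.univ soluble) :
    (nilpotent.prod L).SatisfiesBoundaryConditionIn Set.univ soluble := by
  obtain ⟨hL, -, l, hl, hbd⟩ := h
  have hne : L.IsNonempty := by
    -- The trivial group has no chief factors.
    refine ⟨PUnit, inferInstance, inferInstance, (hl.mem_iff _).2 fun H K _ _ hHK => ?_⟩
    exact absurd (Subsingleton.elim K H) hHK.lt.ne
  refine satisfiesBoundaryConditionIn_nilpotent_prod hL hne fun p _ =>
    mem_nilpotent_prod_of_isCritical hL hne p (fun G _ _ A _ hG => ?_) fun G _ _ hG hcrit hq => ?_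
  · have : Group.IsSolvable G := hG
    change Group.IsSolvable (G ⧸ A)
    infer_instance
  have hsol : Group.IsSolvable G := hG
  by_contra hGF
  obtain ⟨N, hN⟩ := exists_isChiefFactor_bot_of_not_mem hGF
  have := hN.normal_top
  obtain ⟨q, hqp, hNq, hC, hGN, hT⟩ :=
    exists_isPGroup_of_isCritical hL hne hcrit hGF hq hN inferInstance
  refine hGN (hbd (G ⧸ N) ?_ ⟨⟨q, hqp⟩, trivial, fun h => hGN (hl.integrated _ _ h),
    fun S hS => ?_⟩)
  · change Group.IsSolvable (G ⧸ N)
    infer_instance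
  · obtain ⟨h1, h2⟩ := exists_subgroup_surjective _ (QuotientGroup.mk'_surjective N) hS
    have hNT : N ≤ S.comap (QuotientGroup.mk' N) := by
      conv_lhs => rw [← QuotientGroup.ker_mk' N]
      exact ker_le_comap _ S
    refine (hl.isFormation _).of_surjective _ h2 (hl.mem_of_centralizer_le ⟨q, hqp⟩ (hT _ hNT h1)
      (N := N.subgroupOf (S.comap (QuotientGroup.mk' N))) (fun hb => hN.lt.ne' ?_)
      hNq.comap_subtype fun x hx => hC (mem_centralizer_iff.2 fun n hn => ?_))
    · rwa [subgroupOf_eq_bot, disjoint_iff, inf_eq_left.2 hNT] at hb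
    · exact congrArg Subtype.val (mem_centralizer_iff.1 hx ⟨n, hNT hn⟩ hn)

/-- If `L` is a formation of nilpotent groups involving all primes, then `N L` satisfies the
boundary condition. -/
theorem nilpotent_prod_boundary_all {L : GroupClass.{u}} (hL : L.IsFormation)
    (hnil : L.Subclass nilpotent) (hpi : L.primeSet = Set.univ) :
    (nilpotent.prod L).SatisfiesBoundaryConditionIn Set.univ all := by
  have hne : L.IsNonempty := by
    obtain ⟨G, i, j, hG, -⟩ : (⟨2, Nat.prime_two⟩ : Nat.Primes) ∈ L.primeSet := hpi ▸ trivial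
    exact ⟨G, i, j, hG⟩
  refine satisfiesBoundaryConditionIn_nilpotent_prod hL hne fun p _ =>
    mem_nilpotent_prod_of_isCritical hL hne p (fun _ _ _ _ _ _ => trivial)
      fun G _ _ _ hcrit hq => ?_
  by_contra hGF
  obtain ⟨N, hN⟩ := exists_isChiefFactor_bot_of_not_mem hGF
  have := hN.normal_top
  have hres : ∀ M : Subgroup G, M ≠ ⊤ → IsPGroup p (L.residual M) ∧
      Group.IsNilpotent (M ⧸ L.residual M) :=
    fun M hM => ⟨hcrit.2 M hM, hnil _ (hL.quotient_residual hne M)⟩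
  have hsol : Group.IsSolvable N := by
    by_cases hNt : N = ⊤
    · have : Nontrivial G := by
        by_contra h
        rw [not_nontrivial_iff_subsingleton] at h
        exact hN.lt.ne (Subsingleton.elim _ _)
      have : IsSimpleGroup G :=
        ⟨fun A hA => hNt ▸ hN.eq_or_eq A hA bot_le (hNt ▸ le_top)⟩
      have := isSolvable_of_forall_extension (G := G) (p := p) fun M hM =>
        ⟨L.residual M, inferInstance, hres M hM⟩
      infer_instance
    · obtain ⟨h1, h2⟩ := hres N hNt
      have := h1.isNilpotent
      rw [Group.isSolvable_iff_subgroup_quotient (L.residual N)]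
      exact ⟨inferInstance, inferInstance⟩
  obtain ⟨q, hqp, hNq, hC, hGN, hT⟩ :=
    exists_isPGroup_of_isCritical hL hne hcrit hGF hq hN hsol
  have := Fact.mk hqp
  -- In the nilpotent group T the q'-elements centralize the q-group N, hence lie in N, hence are
  -- trivial.
  have hTq : ∀ T : Subgroup G, N ≤ T → T ≠ ⊤ → IsPGroup q T := by
    intro T hNT hTt x
    have hTn : Group.IsNilpotent T := hnil T (hT T hNT hTt)
    obtain ⟨k, hk⟩ := exists_pow_orderOf_coprime q x
    have hmem : ((x ^ q ^ k : T) : G) ∈ N := hC (mem_centralizer_iff.2 fun n hn => by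
      obtain ⟨m, hm⟩ := hNq ⟨n, hn⟩
      have h1 : (⟨n, hNT hn⟩ : T) ^ q ^ m = 1 := Subtype.ext (by
        change n ^ q ^ m = 1
        exact congrArg Subtype.val hm)
      exact (congrArg Subtype.val (Group.IsNilpotent.commute_of_coprime hk h1).eq).symm)
    have h1 := hNq.eq_one_of_orderOf_coprime (x := ⟨_, hmem⟩) (by rwa [orderOf_mk, orderOf_coe])
    exact ⟨k, Subtype.ext (congrArg (Subtype.val : N → G) h1)⟩
  by_cases hGq : IsPGroup q (G ⧸ N)
  · have hGpg : IsPGroup q G := by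
      rw [IsPGroup.iff_card] at hGq hNq ⊢
      obtain ⟨a, ha⟩ := hGq
      obtain ⟨b, hb⟩ := hNq
      exact ⟨a + b, by rw [card_eq_card_quotient_mul_card_subgroup N, ha, hb, pow_add]⟩
    exact hGF (hGpg.to_subgroup (L.residual G)).isNilpotent
  · rw [isPGroup_iff_primeFactors_card_subset hqp.ne_zero, hqp.primeFactors,
      Finset.not_subset] at hGq
    obtain ⟨r, hr, hrq⟩ := hGq
    rw [Finset.mem_singleton] at hrq
    have hrp := Nat.prime_of_mem_primeFactors hr
    have := Fact.mk hrp
    obtain ⟨x, hx⟩ := exists_prime_orderOf_dvd_card' r (Nat.dvd_of_mem_primeFactors hr)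
    -- A proper subgroup of G/N is a q-group and cannot contain an element of order r ≠ q.
    have htop : zpowers x = ⊤ := by
      by_contra hS
      obtain ⟨h1, h2⟩ := exists_subgroup_surjective _ (QuotientGroup.mk'_surjective N) hS
      have hNT : N ≤ (zpowers x).comap (QuotientGroup.mk' N) := by
        conv_lhs => rw [← QuotientGroup.ker_mk' N]
        exact ker_le_comap _ _
      have h3 := (hTq _ hNT h1).of_surjective _ h2
      have h4 := h3.eq_one_of_orderOf_coprime (x := ⟨x, mem_zpowers x⟩)
        (by rw [orderOf_mk, hx]; exact (Nat.coprime_primes hrp hqp).2 hrq)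
      have h5 : x = 1 := congrArg Subtype.val h4
      rw [h5, orderOf_one] at hx
      exact hrp.one_lt.ne hx
    refine hGN (hL.mem_of_card_eq_prime hnil (r := ⟨r, hrp⟩) (hpi ▸ trivial) ?_)
    rw [← card_top, ← htop, Nat.card_zpowers, hx]

end GroupClass

theorem proposition4p9 (L : GroupClass.{u}) :
    (L.IsFormation → L.IsHereditary → L.IsSaturated →
      L.SatisfiesBoundaryConditionIn Set.univ GroupClass.soluble →
      (GroupClass.nilpotent.prod L).SatisfiesBoundaryConditionIn Set.univ GroupClass.soluble) ∧
    (L.IsFormation → L.Subclass GroupClass.nilpotent → L.primeSet = Set.univ →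
      (GroupClass.nilpotent.prod L).SatisfiesBoundaryConditionIn Set.univ GroupClass.all) := by
  exact ⟨fun _ _ _ h => GroupClass.nilpotent_prod_boundary_soluble h,
    fun hL hnil hpi => GroupClass.nilpotent_prod_boundary_all hL hnil hpi⟩
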